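/- **Corollary 4.16.** Every $l$-Grigorchuk subshift is uniquely ergodic. In detail: let $l = (l_k)_{k \in \mathbb{N}}$ be a sequence of positive integers. For $\beta \in \{x,y,z\}$ let $\tau_\beta$ be the semigroup homomorphism on the finite words over the alphabet $\{a,x,y,z\}$ given by $\tau_\beta(a) = a\beta a$, $\tau_\beta(x) = x$, $\tau_\beta(y) = y$, $\tau_\beta(z) = z$. For an integer $n \geq 0$ let $\beta_n$ be $x$, $y$ or $z$ according as $n \equiv 0$, $1$ or $2 \pmod 3$. For an integer $j \geq 0$ let $N(j) \geq 0$ and $q(j)$ be the unique integers with $$ j = q(j) + \sum_{i=1}^{N(j)} l_i , \qquad 0 \leq q(j) < l_{N(j)+1}, $$ and set $$ \tau^{(j)} = \tau_{\beta_0}^{l_1} \circ \tau_{\beta_1}^{l_2} \circ \dots \circ \tau_{\beta_{N(j)-1}}^{l_{N(j)}} \circ \tau_{\beta_{N(j)}}^{q(j)} . $$ Let $\eta_l$ be the unique infinite word $\eta_l \in \{a,x,y,z\}^{\mathbb{N}}$ that has $\tau^{(j)}(a)$ as a prefix for every $j \geq 0$. Let $\sigma(x_1, x_2, x_3, \dots)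 = (x_2, x_3, \dots)$ be the left shift on $\{a,x,y,z\}^{\mathbb{N}}$, which carries the product of the discrete topologies, and let $$ \Omega(\eta_l) = \overline{\{ \sigma^k(\eta_l) : k \geq 0 \}} $$ be the subshift generated by $\eta_l$ (the $l$-Grigorchuk subshift). Then the dynamical system $(\Omega(\eta_l), \sigma)$ is uniquely ergodic, that is, there is exactly one Borel probability measure on $\Omega(\eta_l)$ that is invariant under $\sigma$. -/

import Mathlib

namespace Grigorchuk

open SymbolicDynamics.FullShift

/-! ### Subshifts generated by a word, and unique ergodicity -/

/-- The subshift `Ω(w)` generated by a one-sided infinite word `w`: the closure, in the product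
topology, of the orbit of `w` under the left shift. -/
def orbitClosure {A : Type*} [TopologicalSpace A] (w : ℕ → A) : Subshift A ℕ where
  carrier := closure (Set.range fun k : ℕ => shift k w)
  isClosed := isClosed_closure
  mapsTo := by
    intro g
    refine Set.MapsTo.closure ?_ (continuous_shift g)
    rintro _ ⟨k, rfl⟩
    exact ⟨k + g, shift_add k g w⟩

/-- The left shift `σ (x₁, x₂, x₃, …) = (x₂, x₃, …)`, as a self-map of a subshift. -/
def leftShift {A : Type*} [TopologicalSpace A] (Y : Subshift A ℕ) : Y.carrier → Y.carrier :=
  (Y.mapsTo 1).restrict (shift (1 : ℕ)) Y.carrier Y.carrier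

/-- A self-map `T` of a topological space is uniquely ergodic if there is exactly one `T`-invariant
Borel probability measure. -/
def IsUniquelyErgodic {X : Type*} [TopologicalSpace X] [MeasurableSpace X] [BorelSpace X]
    (T : X → X) : Prop :=
  ∃! μ : MeasureTheory.Measure X,
    MeasureTheory.IsProbabilityMeasure μ ∧ MeasureTheory.MeasurePreserving T μ μ

/-! ### The alphabet and the substitutions -/

/-- The alphabet `{a, x, y, z}`, with the discrete topology and its Borel `σ`-algebra. -/
inductive Letter : Type
  | a | x | y | z
  deriving DecidableEq

instance : Fintype Letter := ⟨{.a, .x, .y, .z}, fun b => by cases b <;> simp⟩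

instance : TopologicalSpace Letter := ⊥

instance : DiscreteTopology Letter := ⟨rfl⟩

instance : MeasurableSpace Letter := ⊤

instance : BorelSpace Letter := ⟨borel_eq_top_of_discrete.symm⟩

/-- The image of a single letter under `τ_β`: it sends `a` to `a β a` and fixes `x`, `y`, `z`. -/
def substLetter (β : Letter) : Letter → List Letter
  | .a => [.a, β, .a]
  | .x => [.x]
  | .y => [.y]
  | .z => [.z]

/-- The homomorphism `τ_β` on finite words. -/
def subst (β : Letter) (w : List Letter) : List Letter :=
  w.flatMap (substLetter β)

/-- The cyclic order `x, y, z, x, y, z, …`. -/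
def cyc (n : ℕ) : Letter :=
  if n % 3 = 0 then .x else if n % 3 = 1 then .y else .z

/-! ### The word attached to a sequence

A sequence `(l₁, l₂, …)` is given as `l : ℕ → ℕ` with `l k` standing for `l_{k+1}`. -/

/-- `N(j)`: the largest `N` with `l₁ + ⋯ + l_N ≤ j` (for positive `l`, every such `N` is at most
`j`). -/
def N (l : ℕ → ℕ) (j : ℕ) : ℕ :=
  Nat.findGreatest (fun n => ∑ i ∈ Finset.range n, l i ≤ j) j

/-- `q(j) = j - (l₁ + ⋯ + l_{N(j)})`. -/
def q (l : ℕ → ℕ) (j : ℕ) : ℕ :=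
  j - ∑ i ∈ Finset.range (N l j), l i

/-- `τ_x^{l₁} ∘ τ_y^{l₂} ∘ τ_z^{l₃} ∘ τ_x^{l₄} ∘ ⋯`, with `n` blocks. -/
def blocks (l : ℕ → ℕ) : ℕ → List Letter → List Letter
  | 0 => id
  | n + 1 => blocks l n ∘ (subst (cyc n))^[l n]

/-- `τ^{(j)}`: the first `N(j)` full blocks, followed by the `q(j)`-th power of the next `τ_β`. -/
def tau (l : ℕ → ℕ) (j : ℕ) : List Letter → List Letter :=
  blocks l (N l j) ∘ (subst (cyc (N l j)))^[q l j]

/-- The infinite word `η_l`, whose `n`-th letter (from `0`) is the `n`-th letter of `τ^{(n)}(a)`;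
for positive `l` it is the only word that has all the `τ^{(j)}(a)` as prefixes, see
`existsUnique_word` and `word_hasPrefix`. -/
def word (l : ℕ → ℕ) (n : ℕ) : Letter :=
  (tau l n [.a]).getD n .a

/-- The finite word `w` is a prefix of the infinite word `u`. -/
def HasPrefix (u : ℕ → Letter) (w : List Letter) : Prop :=
  ∀ (i : ℕ) (hi : i < w.length), u i = w[i]

/-- The `l`-Grigorchuk subshift `Ω(η_l)`. -/
def grigorchukSubshift (l : ℕ → ℕ) : Subshift Letter ℕ :=
  orbitClosure (word l)

/-! ### The definitions above are as intended -/

theorem le_sum_range {l : ℕ → ℕ} (hl : ∀ k, 0 < l k) (n : ℕ) :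
    n ≤ ∑ i ∈ Finset.range n, l i := by
  induction n with
  | zero => simp
  | succ n ih => rw [Finset.sum_range_succ]; have := hl n; omega

/-- `j = q(j) + (l₁ + ⋯ + l_{N(j)})` with `0 ≤ q(j) < l_{N(j)+1}`. -/
theorem N_q_spec {l : ℕ → ℕ} (hl : ∀ k, 0 < l k) (j : ℕ) :
    j = q l j + ∑ i ∈ Finset.range (N l j), l i ∧ q l j < l (N l j) := by
  have h1 : ∑ i ∈ Finset.range (N l j), l i ≤ j :=
    Nat.findGreatest_spec (P := fun n => ∑ i ∈ Finset.range n, l i ≤ j) (Nat.zero_le j) (by simp)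
  have h2 : j < ∑ i ∈ Finset.range (N l j + 1), l i := by
    by_contra! h
    have h3 : N l j + 1 ≤ j := (le_sum_range hl _).trans h
    have : N l j + 1 ≤ N l j :=
      Nat.le_findGreatest (P := fun n => ∑ i ∈ Finset.range n, l i ≤ j) h3 h
    omega
  rw [Finset.sum_range_succ] at h2
  unfold q
  omega

/-- `N(j)` and `q(j)` are determined by `N_q_spec`. -/
theorem N_q_unique {l : ℕ → ℕ} (hl : ∀ k, 0 < l k) {j n r : ℕ}
    (h : j = r + ∑ i ∈ Finset.range n, l i) (hr : r < l n) : N l j = n ∧ q l j = r := by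
  have hm : Monotone fun n => ∑ i ∈ Finset.range n, l i := fun s t hst =>
    Finset.sum_le_sum_of_subset (Finset.range_mono hst)
  obtain ⟨h1, h2⟩ := N_q_spec hl j
  have hN : N l j = n := by
    rcases lt_trichotomy (N l j) n with hlt | heq | hgt
    · have := hm (Nat.succ_le_of_lt hlt)
      simp only [Nat.succ_eq_add_one, Finset.sum_range_succ] at this
      omega
    · exact heq
    · have := hm (Nat.succ_le_of_lt hgt)
      simp only [Nat.succ_eq_add_one, Finset.sum_range_succ] at this
      omega
  refine ⟨hN, ?_⟩
  rw [hN] at h1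
  omega

theorem tau_zero (l : ℕ → ℕ) : tau l 0 = id := by
  simp [tau, N, q, blocks]

theorem tau_succ {l : ℕ → ℕ} (hl : ∀ k, 0 < l k) (j : ℕ) :
    tau l (j + 1) = tau l j ∘ subst (cyc (N l j)) := by
  obtain ⟨h1, h2⟩ := N_q_spec hl j
  by_cases h : q l j + 1 < l (N l j)
  · obtain ⟨h3, h4⟩ := N_q_unique hl (j := j + 1) (n := N l j) (r := q l j + 1) (by omega) h
    unfold tau
    rw [h3, h4, Function.iterate_succ, Function.comp_assoc]
  · obtain ⟨h3, h4⟩ := N_q_unique hl (j := j + 1) (n := N l j + 1) (r := 0)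
      (by rw [Finset.sum_range_succ]; omega) (hl _)
    have h5 : l (N l j) = q l j + 1 := by omega
    unfold tau
    rw [h3, h4, Function.comp_assoc, ← Function.iterate_succ, blocks, h5]
    rfl

theorem subst_append (β : Letter) (u v : List Letter) :
    subst β (u ++ v) = subst β u ++ subst β v := by
  simp [subst]

theorem tau_append {l : ℕ → ℕ} (hl : ∀ k, 0 < l k) (j : ℕ) (u v : List Letter) :
    tau l j (u ++ v) = tau l j u ++ tau l j v := by
  induction j generalizing u v with
  | zero => simp [tau_zero]
  | succ j ih => simp [tau_succ hl, subst_append, ih]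

theorem tau_singleton {l : ℕ → ℕ} (hl : ∀ k, 0 < l k) (j : ℕ) {b : Letter} (hb : b ≠ .a) :
    tau l j [b] = [b] := by
  induction j with
  | zero => simp [tau_zero]
  | succ j ih =>
    have : subst (cyc (N l j)) [b] = [b] := by
      cases b <;> simp_all [subst, substLetter]
    simp [tau_succ hl, this, ih]

theorem cyc_ne (n : ℕ) : cyc n ≠ .a := by
  unfold cyc; split_ifs <;> simp

/-- `τ^{(j+1)}(a) = τ^{(j)}(a) β^{(j)} τ^{(j)}(a)`. -/
theorem tau_succ_a {l : ℕ → ℕ} (hl : ∀ k, 0 < l k) (j : ℕ) :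
    tau l (j + 1) [.a] = tau l j [.a] ++ [cyc (N l j)] ++ tau l j [.a] := by
  have h : subst (cyc (N l j)) [.a] = [.a] ++ [cyc (N l j)] ++ [.a] := by
    simp [subst, substLetter]
  rw [tau_succ hl, Function.comp_apply, h, tau_append hl, tau_append hl,
    tau_singleton hl j (cyc_ne _)]

theorem length_tau_a {l : ℕ → ℕ} (hl : ∀ k, 0 < l k) (j : ℕ) :
    (tau l j [.a]).length + 1 = 2 ^ (j + 1) := by
  induction j with
  | zero => simp [tau_zero]
  | succ j ih => rw [tau_succ_a hl, pow_succ, ← ih]; simp; omega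

theorem lt_length_tau_a {l : ℕ → ℕ} (hl : ∀ k, 0 < l k) (j : ℕ) :
    j < (tau l j [.a]).length := by
  have h1 := length_tau_a hl j
  have h2 : j + 1 < 2 ^ (j + 1) := Nat.lt_two_pow_self
  omega

theorem tau_a_prefix {l : ℕ → ℕ} (hl : ∀ k, 0 < l k) {i j : ℕ} (hij : i ≤ j) :
    tau l i [.a] <+: tau l j [.a] := by
  induction j, hij using Nat.le_induction with
  | base => exact List.prefix_rfl
  | succ j _ ih =>
    refine ih.trans ?_
    rw [tau_succ_a hl, List.append_assoc]
    exact List.prefix_append _ _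

/-- Every `τ^{(j)}(a)` is a prefix of `η_l`. -/
theorem word_hasPrefix {l : ℕ → ℕ} (hl : ∀ k, 0 < l k) (j : ℕ) :
    HasPrefix (word l) (tau l j [.a]) := by
  intro i hi
  have hi' := lt_length_tau_a hl i
  rw [word, List.getD_eq_getElem _ _ hi']
  rcases le_total i j with h | h
  · exact (tau_a_prefix hl h).getElem hi'
  · exact ((tau_a_prefix hl h).getElem hi).symm

/-- There is exactly one infinite word with all the `τ^{(j)}(a)` as prefixes. -/
theorem existsUnique_word {l : ℕ → ℕ} (hl : ∀ k, 0 < l k) :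
    ∃! u : ℕ → Letter, ∀ j, HasPrefix u (tau l j [.a]) := by
  refine ⟨word l, word_hasPrefix hl, fun u hu => funext fun n => ?_⟩
  have h := lt_length_tau_a hl n
  rw [hu n n h, word_hasPrefix hl n n h]

end Grigorchuk

/-!
The word `η_l` is a Toeplitz word: since `τ^{(j+1)}(a) = τ^{(j)}(a) β τ^{(j)}(a)` with
`|τ^{(j)}(a)| = 2 ^ (j + 1) - 1`, its `n`-th letter depends only on the `2`-adic valuation of
`n + 1` (`exists_word_eq_toeplitz`). The theorem holds for the orbit closure of any such word
`n ↦ c (v₂ (n + 1))`.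

*Uniqueness.* Away from the single residue class `n + 1 ≡ 0` modulo `2 ^ m`, the word is periodic
with period `2 ^ m`. Hence the number of visits, during `2 ^ m` steps, to a cylinder given by a
finite set `s` of coordinates depends on the starting point only up to `s.card`
(`abs_birkhoffSum_indicator_sub_le`). Integrating this against two invariant measures, dividing by
`2 ^ m` and letting `m → ∞` shows that they agree on cylinders, hence everywhere
(`invariant_measure_unique`).

*Existence.* The coding `x ↦ (c (v₂ (x + n + 1)))_n` of the `2`-adic integers intertwines `x ↦ x + 1`
with the shift, and sends every `x` that is not a negative integer into the subshift, by density of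
`ℕ` in `ℤ_[2]` (`padicToeplitz_mem`). The push-forward of the Haar measure is therefore an invariant
probability measure on the subshift (`exists_invariant_measure`).
-/

namespace Grigorchuk

open SymbolicDynamics.FullShift MeasureTheory Set Filter Topology

/-! ### The Grigorchuk words are Toeplitz words -/

/-- The one-sided Toeplitz word whose `n`-th letter (from `0`) is `c v`, where `2 ^ v` is the
largest power of `2` dividing `n + 1`. -/
def toeplitz {A : Type*} (c : ℕ → A) (n : ℕ) : A :=
  c (padicValNat 2 (n + 1))

theorem padicValNat_eq_of_modEq {m a b : ℕ} (hab : a ≡ b [MOD 2 ^ m]) (ha : ¬ 2 ^ m ∣ a) :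
    padicValNat 2 a = padicValNat 2 b := by
  have hb : ¬ 2 ^ m ∣ b := fun h => ha ((hab.dvd_iff dvd_rfl).2 h)
  have ha0 : a ≠ 0 := by rintro rfl; simp at ha
  have hb0 : b ≠ 0 := by rintro rfl; simp at hb
  have key : ∀ k, k ≤ padicValNat 2 a ↔ k ≤ padicValNat 2 b := by
    intro k
    rw [← padicValNat_dvd_iff_le ha0, ← padicValNat_dvd_iff_le hb0]
    rcases le_total k m with hk | hk
    · exact hab.dvd_iff (pow_dvd_pow 2 hk)
    · exact iff_of_false (fun h => ha ((pow_dvd_pow 2 hk).trans h))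
        (fun h => hb ((pow_dvd_pow 2 hk).trans h))
  exact le_antisymm ((key _).1 le_rfl) ((key _).2 le_rfl)

theorem toeplitz_eq_of_modEq {A : Type*} (c : ℕ → A) {m n n' : ℕ} (h : n ≡ n' [MOD 2 ^ m])
    (hn : ¬ 2 ^ m ∣ n + 1) : toeplitz c n = toeplitz c n' :=
  congrArg c (padicValNat_eq_of_modEq (h.add_right 1) hn)

theorem exists_word_eq_toeplitz {l : ℕ → ℕ} (hl : ∀ k, 0 < l k) :
    ∃ c : ℕ → Letter, word l = toeplitz c := by
  let c : ℕ → Letter := fun v => Nat.casesOn v .a fun j => cyc (N l j)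
  have key : ∀ j i (hi : i < (tau l j [.a]).length), (tau l j [.a])[i] = toeplitz c i := by
    intro j
    induction j with
    | zero =>
      intro i hi
      have : i = 0 := by simpa [tau_zero] using hi
      subst this
      simp [tau_zero, toeplitz, c]
    | succ j ih =>
      intro i hi
      have h1 := length_tau_a hl j
      have h2 := length_tau_a hl (j + 1)
      rw [pow_succ] at h2
      simp only [tau_succ_a hl, List.append_assoc]
      rw [List.getElem_append]
      split_ifs with h
      · exact ih i h
      · rw [List.getElem_append]
        split_ifs with h'
        · simp only [List.length_singleton] at h'
          have : i + 1 = 2 ^ (j + 1) := by omega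
          simp [toeplitz, this, c]
        · simp only [List.length_singleton] at h' ⊢
          -- the second copy of `τ^{(j)}(a)` is shifted by `2 ^ (j + 1)`
          rw [ih]
          have hmod : i - (tau l j [.a]).length - 1 + 2 ^ (j + 1) = i := by omega
          refine toeplitz_eq_of_modEq c (m := j + 1) ?_ ?_
          · conv_rhs => rw [← hmod]
            simp [Nat.ModEq]
          · exact Nat.not_dvd_of_pos_of_lt (by omega) (by omega)
  refine ⟨c, funext fun n => ?_⟩
  rw [word_hasPrefix hl n n (lt_length_tau_a hl n), key]

/-! ### Visits to cylinders over `2 ^ m` steps -/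

/-- Each element of `s` accounts for one bad residue class modulo `M`. -/
theorem card_filter_dvd_add_le (s : Finset ℕ) {M : ℕ} (hM : 0 < M) :
    ((Finset.range M).filter fun r => ∃ i ∈ s, M ∣ r + i + 1).card ≤ s.card := by
  refine (Finset.card_le_card (t := s.image fun i => M - 1 - i % M) ?_).trans Finset.card_image_le
  intro r hr
  simp only [Finset.mem_filter, Finset.mem_range] at hr
  obtain ⟨hrM, i, hi, hd⟩ := hr
  refine Finset.mem_image.2 ⟨i, hi, ?_⟩
  have hi' := Nat.mod_lt i hM
  have hd' : M ∣ r + i % M + 1 := by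
    have : r + i + 1 = r + i % M + 1 + M * (i / M) := by
      have := Nat.mod_add_div i M
      omega
    rw [this] at hd
    exact (Nat.dvd_add_left (dvd_mul_right _ _)).1 hd
  obtain ⟨t, ht⟩ := hd'
  have : t = 1 := by
    rcases t with _ | _ | t
    · simp at ht
    · rfl
    · nlinarith
  subst this
  omega

/-- The sum of a `[0, 1]`-valued function over a window of length `M` is independent of the
position of the window, up to the number of residue classes on which the function fails to be
`M`-periodic. -/
theorem abs_sum_Ico_sub_sum_range_le {f : ℕ → ℝ} (hf0 : ∀ n, 0 ≤ f n) (hf1 : ∀ n, f n ≤ 1)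
    (s : Finset ℕ) {M : ℕ} (hM : 0 < M)
    (hf : ∀ n n', n ≡ n' [MOD M] → (∀ i ∈ s, ¬ M ∣ n + i + 1) → f n = f n') (p : ℕ) :
    |∑ n ∈ Finset.Ico p (p + M), f n - ∑ r ∈ Finset.range M, f r| ≤ s.card := by
  classical
  have hre : ∀ F : ℕ → ℝ,
      ∑ r ∈ Finset.range M, F r = ∑ n ∈ Finset.Ico p (p + M), F (n % M) := by
    intro F
    rw [← Nat.image_Ico_mod p M, Finset.sum_image]
    simpa using Nat.mod_injOn_Ico p M
  rw [hre f, ← Finset.sum_sub_distrib]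
  refine (Finset.abs_sum_le_sum_abs _ _).trans ?_
  calc ∑ n ∈ Finset.Ico p (p + M), |f n - f (n % M)|
      ≤ ∑ n ∈ Finset.Ico p (p + M), (if ∃ i ∈ s, M ∣ n % M + i + 1 then (1 : ℝ) else 0) := by
        refine Finset.sum_le_sum fun n _ => ?_
        split_ifs with h
        · rw [abs_le]
          constructor <;> linarith [hf0 n, hf1 n, hf0 (n % M), hf1 (n % M)]
        · push Not at h
          rw [hf (n % M) n (Nat.mod_modEq n M) h, sub_self, abs_zero]
    _ = ∑ r ∈ Finset.range M, (if ∃ i ∈ s, M ∣ r + i + 1 then (1 : ℝ) else 0) :=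
        (hre fun r => if ∃ i ∈ s, M ∣ r + i + 1 then (1 : ℝ) else 0).symm
    _ ≤ s.card := by
        rw [Finset.sum_boole]
        exact_mod_cast card_filter_dvd_add_le s hM

theorem leftShift_iterate {A : Type*} [TopologicalSpace A] (Y : Subshift A ℕ) (k : ℕ)
    (y : Y.carrier) : ((leftShift Y)^[k] y : ℕ → A) = shift k y.1 := by
  induction k generalizing y with
  | zero => simp
  | succ k ih =>
    rw [Function.iterate_succ_apply, ih]
    funext n
    change y.1 (1 + (k + n)) = y.1 (k + 1 + n)
    rw [← add_assoc, add_comm 1 k]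

theorem exists_shift_eqOn {A : Type*} [TopologicalSpace A] [DiscreteTopology A] {w y : ℕ → A}
    (hy : y ∈ (orbitClosure w).carrier) (s : Finset ℕ) : ∃ p, ∀ i ∈ s, w (p + i) = y i := by
  obtain ⟨_, hz, p, rfl⟩ := mem_closure_iff.1 hy _ (isOpen_cylinder s y) (fun _ _ => rfl)
  exact ⟨p, hz⟩

/-- Over `2 ^ m` steps, all points of the Toeplitz subshift visit a set depending only on the
coordinates in `s` equally often, up to `s.card`. -/
theorem abs_birkhoffSum_indicator_sub_le {A : Type*} [TopologicalSpace A] [DiscreteTopology A]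
    (c : ℕ → A) (s : Finset ℕ) (C : Set (ℕ → A))
    (hC : ∀ u v : ℕ → A, (∀ i ∈ s, u i = v i) → (u ∈ C ↔ v ∈ C)) (m : ℕ)
    (y : (orbitClosure (toeplitz c)).carrier) :
    |birkhoffSum (leftShift (orbitClosure (toeplitz c))) ((Subtype.val ⁻¹' C).indicator 1) (2 ^ m) y
      - ∑ r ∈ Finset.range (2 ^ m), C.indicator (1 : (ℕ → A) → ℝ) (shift r (toeplitz c))|
      ≤ s.card := by
  set f : ℕ → ℝ := fun n => C.indicator (1 : (ℕ → A) → ℝ) (shift n (toeplitz c))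
  have hind : ∀ u v : ℕ → A, (∀ i ∈ s, u i = v i) →
      C.indicator (1 : (ℕ → A) → ℝ) u = C.indicator 1 v := by
    intro u v huv
    classical
    simp only [indicator_apply, hC u v huv, Pi.one_apply]
  have hf : ∀ n n', n ≡ n' [MOD 2 ^ m] → (∀ i ∈ s, ¬ 2 ^ m ∣ n + i + 1) → f n = f n' :=
    fun n n' hn hb => hind _ _ fun i hi => toeplitz_eq_of_modEq c (hn.add_right i) (hb i hi)
  have hf0 : ∀ n, 0 ≤ f n := fun n => indicator_nonneg (fun _ _ => zero_le_one) _
  have hf1 : ∀ n, f n ≤ 1 := fun n => indicator_le_self' (fun _ _ => zero_le_one) _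
  classical
  -- a finite window of `y` that sees `C` along the first `2 ^ m` shifts occurs in the word
  obtain ⟨p, hp⟩ := exists_shift_eqOn y.2
    ((Finset.range (2 ^ m) ×ˢ s).image fun t => t.1 + t.2)
  have hsum : birkhoffSum (leftShift (orbitClosure (toeplitz c)))
      ((Subtype.val ⁻¹' C).indicator 1) (2 ^ m) y
      = ∑ n ∈ Finset.Ico p (p + 2 ^ m), f n := by
    rw [birkhoffSum, Finset.sum_Ico_eq_sum_range, Nat.add_sub_cancel_left]
    refine Finset.sum_congr rfl fun k hk => ?_
    change C.indicator (1 : (ℕ → A) → ℝ)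
      ((leftShift (orbitClosure (toeplitz c)))^[k] y).1 = _
    rw [leftShift_iterate]
    refine hind _ _ fun i hi => ?_
    have := hp (k + i) (Finset.mem_image.2 ⟨(k, i), Finset.mk_mem_product hk hi, rfl⟩)
    simpa [add_assoc] using this.symm
  rw [hsum]
  exact abs_sum_Ico_sub_sum_range_le hf0 hf1 s (by positivity) hf p

/-! ### Uniqueness of the invariant measure -/

/-- If every orbit visits `B` about `b` times in `n` steps, up to an error `K`, then so does the
average orbit for any invariant measure, and `n * μ.real B` is that average number of visits. -/
theorem abs_mul_measureReal_sub_le {X : Type*} [MeasurableSpace X] {T : X → X} {μ : Measure X}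
    [IsProbabilityMeasure μ] (hT : MeasurePreserving T μ μ) {B : Set X} (hB : MeasurableSet B)
    {n : ℕ} {b K : ℝ} (h : ∀ x, |birkhoffSum T (B.indicator 1) n x - b| ≤ K) :
    |n * μ.real B - b| ≤ K := by
  have hmeas : Measurable (B.indicator (1 : X → ℝ)) := measurable_one.indicator hB
  have hint : Integrable (B.indicator (1 : X → ℝ)) μ :=
    (integrable_const (1 : ℝ)).indicator hB
  have hk : ∀ k, Integrable (fun x => B.indicator (1 : X → ℝ) (T^[k] x)) μ := fun k =>
    (hT.iterate k).integrable_comp_of_integrable hint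
  have hI : ∫ x, birkhoffSum T (B.indicator (1 : X → ℝ)) n x ∂μ = n * μ.real B := by
    simp only [birkhoffSum]
    rw [integral_finsetSum _ fun k _ => hk k]
    have : ∀ k, ∫ x, B.indicator (1 : X → ℝ) (T^[k] x) ∂μ = μ.real B := fun k => by
      rw [← integral_map (hT.iterate k).aemeasurable hmeas.aestronglyMeasurable,
        (hT.iterate k).map_eq, integral_indicator_one hB]
    simp [this]
  have hbi : Integrable (fun x => birkhoffSum T (B.indicator (1 : X → ℝ)) n x) μ :=
    integrable_finsetSum _ fun k _ => hk k
  have := norm_integral_le_of_norm_le_const (μ := μ) (C := K)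
    (Eventually.of_forall fun x => (Real.norm_eq_abs _).trans_le (h x))
  rwa [integral_sub hbi (integrable_const b), hI, integral_const, probReal_univ, one_smul,
    mul_one, Real.norm_eq_abs] at this

/-- On a cylinder `C` over `s`, two invariant measures satisfy `2 ^ m * |μ C - ν C| ≤ 2 * s.card`
for every `m`, so they coincide. -/
theorem invariant_measure_unique {A : Type*} [TopologicalSpace A] [DiscreteTopology A]
    [MeasurableSpace A] (c : ℕ → A)
    {μ ν : Measure (orbitClosure (toeplitz c)).carrier}
    [IsProbabilityMeasure μ] [IsProbabilityMeasure ν]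
    (hμ : MeasurePreserving (leftShift (orbitClosure (toeplitz c))) μ μ)
    (hν : MeasurePreserving (leftShift (orbitClosure (toeplitz c))) ν ν) : μ = ν := by
  refine ext_of_generate_finite
    (preimage Subtype.val '' measurableCylinders fun _ : ℕ => A) ?_ ?_ ?_ (by simp)
  · rw [← MeasurableSpace.comap_generateFrom, generateFrom_measurableCylinders]
    rfl
  · exact isPiSystem_measurableCylinders.comap _
  · rintro _ ⟨C, hC, rfl⟩
    obtain ⟨s, S, hS, rfl⟩ := (mem_measurableCylinders C).1 hC
    have hB : MeasurableSet ((Subtype.val : (orbitClosure (toeplitz c)).carrier → _) ⁻¹'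
        MeasureTheory.cylinder s S) := measurable_subtype_coe (.cylinder s hS)
    have hdep : ∀ u v : ℕ → A, (∀ i ∈ s, u i = v i) →
        (u ∈ MeasureTheory.cylinder s S ↔ v ∈ MeasureTheory.cylinder s S) := by
      intro u v huv
      have : s.restrict u = s.restrict v := funext fun i => huv i i.2
      rw [MeasureTheory.mem_cylinder, MeasureTheory.mem_cylinder, this]
    have hm : ∀ m : ℕ, |μ.real (Subtype.val ⁻¹' MeasureTheory.cylinder s S)
        - ν.real (Subtype.val ⁻¹' MeasureTheory.cylinder s S)| * 2 ^ m ≤ 2 * s.card := by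
      intro m
      have h1 := abs_mul_measureReal_sub_le hμ hB
        (abs_birkhoffSum_indicator_sub_le c s _ hdep m)
      have h2 := abs_mul_measureReal_sub_le hν hB
        (abs_birkhoffSum_indicator_sub_le c s _ hdep m)
      push_cast at h1 h2
      rw [← abs_of_pos (show (0 : ℝ) < 2 ^ m by positivity), ← abs_mul]
      rw [abs_le] at *
      constructor <;> linarith [h1.1, h1.2, h2.1, h2.2]
    have h0 : |μ.real (Subtype.val ⁻¹' MeasureTheory.cylinder s S)
        - ν.real (Subtype.val ⁻¹' MeasureTheory.cylinder s S)| = 0 := by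
      by_contra hne
      have hpos := lt_of_le_of_ne (abs_nonneg _) (Ne.symm hne)
      obtain ⟨m, hm'⟩ := pow_unbounded_of_one_lt
        (2 * s.card / |μ.real (Subtype.val ⁻¹' MeasureTheory.cylinder s S)
          - ν.real (Subtype.val ⁻¹' MeasureTheory.cylinder s S)|) (one_lt_two : (1 : ℝ) < 2)
      rw [div_lt_iff₀' hpos] at hm'
      exact absurd (hm m) (not_le.2 hm')
    rw [abs_eq_zero, sub_eq_zero] at h0
    exact (measureReal_eq_measureReal_iff).1 h0

/-! ### The coding of the `2`-adic integers -/

/-- The extension of the Toeplitz coding to the `2`-adic integers: the `n`-th letter of the word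
attached to `x` is `c v`, where `v` is the valuation of `x + n + 1`. It takes the junk value
`c 0` at the single `n`, if any, for which `x + n + 1 = 0`. -/
noncomputable def padicToeplitz {A : Type*} (c : ℕ → A) (x : ℤ_[2]) (n : ℕ) : A :=
  c (x + n + 1).valuation

theorem padicToeplitz_natCast {A : Type*} (c : ℕ → A) (k : ℕ) :
    padicToeplitz c k = shift k (toeplitz c) := by
  funext n
  have : ((k : ℤ_[2]) + n + 1).valuation = padicValNat 2 (k + n + 1) := by
    have h : (((k : ℤ_[2]) + n + 1 : ℤ_[2]) : ℚ_[2]).valuation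
        = ((k + n + 1 : ℕ) : ℚ_[2]).valuation := by push_cast; rfl
    rw [PadicInt.valuation_coe, Padic.valuation_natCast] at h
    exact_mod_cast h
  simp [padicToeplitz, toeplitz, this]

theorem continuousAt_valuation {x : ℤ_[2]} (hx : x ≠ 0) :
    ContinuousAt (PadicInt.valuation : ℤ_[2] → ℕ) x := by
  refine continuousAt_const.congr (f := fun _ => x.valuation) ?_
  filter_upwards [Metric.ball_mem_nhds x (norm_pos_iff.2 hx)] with y hy
  have hxy : ‖y‖ = ‖x‖ := by
    rw [← norm_neg y]
    refine PadicInt.norm_eq_of_norm_add_lt_right ?_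
    rwa [neg_add_eq_sub, ← dist_eq_norm, dist_comm]
  have hy0 : y ≠ 0 := by rw [← norm_pos_iff, hxy]; exact norm_pos_iff.2 hx
  rw [PadicInt.norm_eq_zpow_neg_valuation hx, PadicInt.norm_eq_zpow_neg_valuation hy0] at hxy
  have := zpow_right_injective₀ (a := ((2 : ℕ) : ℝ)) (by norm_num) (by norm_num) hxy
  omega

/-- The coding is continuous at such an `x`, and it maps the dense set `ℕ` into the orbit of the
Toeplitz word. -/
theorem padicToeplitz_mem {A : Type*} [TopologicalSpace A] [DiscreteTopology A]
    (c : ℕ → A) {x : ℤ_[2]} (hx : ∀ n : ℕ, x + n + 1 ≠ 0) :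
    padicToeplitz c x ∈ (orbitClosure (toeplitz c)).carrier := by
  have hcont : ContinuousAt (padicToeplitz c) x := by
    refine continuousAt_pi.2 fun n => ?_
    have h1 : ContinuousAt c (x + n + 1).valuation := continuous_of_discreteTopology.continuousAt
    exact h1.comp (f := fun x : ℤ_[2] => (x + n + 1).valuation)
      ((continuousAt_valuation (hx n)).comp (f := fun x : ℤ_[2] => x + n + 1) (by fun_prop))
  refine closure_mono ?_ (hcont.continuousWithinAt.mem_closure_image
    (PadicInt.denseRange_natCast x))
  rintro _ ⟨_, ⟨k, rfl⟩, rfl⟩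
  exact ⟨k, (padicToeplitz_natCast c k).symm⟩

theorem ae_padicToeplitz_mem {A : Type*} [TopologicalSpace A] [DiscreteTopology A]
    [MeasurableSpace ℤ_[2]] [BorelSpace ℤ_[2]] (c : ℕ → A) (μ : Measure ℤ_[2]) [μ.IsAddHaarMeasure] :
    ∀ᵐ x ∂μ, padicToeplitz c x ∈ (orbitClosure (toeplitz c)).carrier := by
  -- `ℤ_[2]` is not discrete, so its Haar measure has no atoms
  have : (𝓝[≠] (0 : ℤ_[2])).NeBot := by
    have h2 : Tendsto (fun k : ℕ => (2 : ℤ_[2]) ^ k) atTop (𝓝[≠] 0) :=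
      tendsto_nhdsWithin_iff.2
        ⟨tendsto_pow_atTop_nhds_zero_of_norm_lt_one (by
            rw [show (2 : ℤ_[2]) = ((2 : ℕ) : ℤ_[2]) by norm_num, PadicInt.norm_p]; norm_num),
          Eventually.of_forall fun k => pow_ne_zero k two_ne_zero⟩
    exact h2.neBot
  have h : ∀ n : ℕ, ∀ᵐ x : ℤ_[2] ∂μ, x + n + 1 ≠ 0 := fun n => by
    have h0 : μ {-((n : ℤ_[2]) + 1)} = 0 := measure_singleton _
    filter_upwards [measure_eq_zero_iff_ae_notMem.1 h0] with x hx h0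
    exact hx (by rw [mem_singleton_iff]; linear_combination h0)
  filter_upwards [ae_all_iff.2 h] with x hx using padicToeplitz_mem c hx

/-! ### Existence of an invariant measure -/

theorem measurable_padicToeplitz {A : Type*} [MeasurableSpace A] [MeasurableSpace ℤ_[2]]
    [BorelSpace ℤ_[2]] (c : ℕ → A) : Measurable (padicToeplitz c) := by
  refine measurable_pi_lambda _ fun n => ?_
  have hval : Measurable (PadicInt.valuation : ℤ_[2] → ℕ) :=
    measurable_of_continuousOn_compl_singleton 0 fun x hx =>
      (continuousAt_valuation hx).continuousWithinAt
  have hc : Measurable c := measurable_from_nat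
  exact hc.comp (hval.comp (by fun_prop))

theorem exists_invariant_measure {A : Type*} [TopologicalSpace A] [DiscreteTopology A]
    [MeasurableSpace A] [BorelSpace A] [Countable A] (c : ℕ → A) :
    ∃ μ : Measure (orbitClosure (toeplitz c)).carrier, IsProbabilityMeasure μ ∧
      MeasurePreserving (leftShift (orbitClosure (toeplitz c))) μ μ := by
  let : MeasurableSpace ℤ_[2] := borel _
  have : BorelSpace ℤ_[2] := ⟨rfl⟩
  let h : Measure ℤ_[2] := Measure.addHaarMeasure ⊤
  have : IsProbabilityMeasure h := ⟨by
    simpa using Measure.addHaarMeasure_self (K₀ := (⊤ : TopologicalSpace.PositiveCompacts ℤ_[2]))⟩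
  have hΦ := measurable_padicToeplitz c
  have hY : MeasurableSet (orbitClosure (toeplitz c)).carrier :=
    (orbitClosure (toeplitz c)).isClosed.measurableSet
  have hemb := MeasurableEmbedding.subtype_coe hY
  have hσ : Measurable (shift 1 : (ℕ → A) → ℕ → A) := (continuous_shift 1).measurable
  have hT : Measurable (leftShift (orbitClosure (toeplitz c))) :=
    (hσ.comp measurable_subtype_coe).subtype_mk
  let μ := (h.map (padicToeplitz c)).comap
    (Subtype.val : (orbitClosure (toeplitz c)).carrier → ℕ → A)
  have hμ : μ.map Subtype.val = h.map (padicToeplitz c) := by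
    rw [map_comap_subtype_coe hY, Measure.restrict_eq_self_of_ae_mem]
    exact (ae_map_iff hΦ.aemeasurable hY).2 (ae_padicToeplitz_mem c h)
  have hinv : (h.map (padicToeplitz c)).map (shift 1) = h.map (padicToeplitz c) := by
    have hcomm : shift 1 ∘ padicToeplitz c = padicToeplitz c ∘ (fun x => x + 1) := by
      funext x n
      simp only [Function.comp_apply, shift_apply, padicToeplitz]
      congr 2
      push_cast
      ring
    rw [Measure.map_map hσ hΦ, hcomm, ← Measure.map_map hΦ (by fun_prop), map_add_right_eq_self]
  refine ⟨μ, ?_, hT, hemb.map_injective ?_⟩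
  · have : IsProbabilityMeasure (μ.map Subtype.val) := by
      rw [hμ]; exact Measure.isProbabilityMeasure_map hΦ.aemeasurable
    exact μ.isProbabilityMeasure_of_map Subtype.val
  · change (μ.map _).map Subtype.val = μ.map Subtype.val
    have : Subtype.val ∘ leftShift (orbitClosure (toeplitz c)) = shift 1 ∘ Subtype.val := rfl
    rw [Measure.map_map measurable_subtype_coe hT, this,
      ← Measure.map_map hσ measurable_subtype_coe, hμ, hinv]

end Grigorchuk

theorem corollary4p16 (l : ℕ → ℕ) (hl : ∀ k, 0 < l k) :
    Grigorchuk.IsUniquelyErgodic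
      (Grigorchuk.leftShift (Grigorchuk.grigorchukSubshift l)) := by
  obtain ⟨c, hc⟩ := Grigorchuk.exists_word_eq_toeplitz hl
  rw [Grigorchuk.grigorchukSubshift, hc]
  obtain ⟨μ, hμp, hμ⟩ := Grigorchuk.exists_invariant_measure c
  refine ⟨μ, ⟨hμp, hμ⟩, fun ν ⟨hνp, hν⟩ => Grigorchuk.invariant_measure_unique c hν hμ⟩
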